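/- Let $m,k,n$ be nonnegative integers with $n\le k$ and let $\rho\in\mathbb{R}$. A system of $n$ equations in $k$ variables over the group $\mathbb{Z}^m$ is a system $$\gamma_{i1}\mathbf{x}_1+\dots+\gamma_{ik}\mathbf{x}_k=\mathbf{b}_i\qquad(i=1,\dots,n)$$ with $\gamma_{ij}\in\mathbb{Z}$ and $\mathbf{b}_i\in\mathbb{Z}^m$; it is identified with its augmented matrix $(A\mid B)\in\mathbb{Z}^{n(k+m)}$, where $A=(\gamma_{ij})$ and $B$ has rows $\mathbf{b}_i$. Let $SAT(\mathbb{Z}^m,k,n)\subseteq\mathbb{Z}^{n(k+m)}$ be the set of those systems that have a solution $\mathbf{x}_1,\dots,\mathbf{x}_k\in\mathbb{Z}^m$. For $r\in\mathbb{N}$ let $B_r^d=\{v\in\mathbb{Z}^d : \|v\|_\infty\le r\}$, where $\|v\|_\infty=\max_i|v_i|$ (equal to $0$ if $d=0$). For an integer $n\times k$ matrix $A$ of rank $n$ let $\gcd(A)$ be the greatest common divisor of its $n\times n$ minors, and put $$F_{m,k,n}(r)=\sum_{\substack{A\in B_r^{nk}\\ \operatorname{rank}(A)=n}}\gcd(A)^{-m}.$$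 Then $SAT(\mathbb{Z}^m,k,n)$ has asymptotic density $\rho$, that is, $$\lim_{r\to\infty}\frac{\bigl|SAT(\mathbb{Z}^m,k,n)\cap B_r^{n(k+m)}\bigr|}{\bigl|B_r^{n(k+m)}\bigr|}$$ exists and equals $\rho$, if and only if $$\lim_{r\to\infty}\frac{F_{m,k,n}(r)}{(2r)^{nk}}$$ exists and equals $\rho$. -/

import Mathlib

open Filter Topology

/-- `M ⊆ T` has asymptotic density `ρ` with respect to the stratification `{T_r}` of a set by finite
subsets: `|M ∩ T_r| / |T_r|` converges to `ρ` as `r → ∞`. -/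
def HasAsymptoticDensity {α : Type*} (T : ℕ → Finset α) (M : Set α) (ρ : ℝ) : Prop :=
  Tendsto (fun r : ℕ => ((M ∩ (T r : Set α)).ncard : ℝ) / ((T r).card : ℝ)) atTop (𝓝 ρ)

/-- The length function given by the uniform norm on integer matrices: the maximal absolute value
of an entry. -/
def uniformLength {p q : Type*} [Fintype p] [Fintype q] (M : Matrix p q ℤ) : ℕ :=
  Finset.univ.sup fun i => Finset.univ.sup fun j => (M i j).natAbs

/-- The ball of radius `r` for the uniform norm in the group of integer `p × q` matrices; it is
written as a box here, and `mem_uniformBall` gives the description by the norm. -/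
noncomputable def uniformBall (p q : Type*) [Fintype p] [DecidableEq p] [Fintype q] [DecidableEq q] (r : ℕ) :
    Finset (Matrix p q ℤ) :=
  (Fintype.piFinset fun _ : p => Fintype.piFinset fun _ : q =>
    Finset.Icc (-(r : ℤ)) (r : ℤ)).map Matrix.of.toEmbedding

theorem mem_uniformBall {p q : Type*} [Fintype p] [DecidableEq p] [Fintype q] [DecidableEq q]
    {r : ℕ} {M : Matrix p q ℤ} : M ∈ uniformBall p q r ↔ uniformLength M ≤ r := by
  simp only [uniformBall, uniformLength, Finset.mem_map_equiv, Fintype.mem_piFinset,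
    Finset.mem_Icc, Finset.sup_le_iff, Finset.mem_univ, true_imp_iff]
  refine forall_congr' fun i => forall_congr' fun j => ?_
  change -(r : ℤ) ≤ M i j ∧ M i j ≤ r ↔ _
  omega

/-- A system of `n` equations `γ_{i1} x_1 + ⋯ + γ_{ik} x_k = b_i` in `k` variables over the group
`ℤ^m`, given by its augmented matrix `(A | B)`; the columns `Sum.inl j` hold the integer coefficients
`γ_{ij}` and the columns `Sum.inr l` hold the coordinates of the `b_i ∈ ℤ^m`. -/
abbrev LinSystem (m k n : ℕ) : Type := Matrix (Fin n) (Fin k ⊕ Fin m) ℤ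

/-- The set of all systems of `n` equations in `k` variables over `ℤ^m` which have a solution
`x_1, …, x_k` in `ℤ^m`. -/
def SAT (m k n : ℕ) : Set (LinSystem m k n) :=
  {S | ∃ x : Fin k → (Fin m → ℤ),
    ∀ i : Fin n, ∑ j : Fin k, S i (Sum.inl j) • x j = fun l => S i (Sum.inr l)}

/-- The greatest divisor of an `n × k` integer matrix (`n ≤ k`): the greatest common divisor of its
`n × n` minors, one for each increasing choice of `n` columns. -/
noncomputable def greatestDivisor {n k : ℕ} (A : Matrix (Fin n) (Fin k) ℤ) : ℕ :=
  (Finset.univ : Finset (Fin n ↪o Fin k)).gcd fun f => (A.submatrix id f).det.natAbs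

/-- `F_{m,k,n}(r)`: the sum of `gcd(A)^{-m}` over all integer `n × k` matrices `A` of rank `n` in the
ball of radius `r`. -/
noncomputable def gcdSum (m k n r : ℕ) : ℝ :=
  ∑ A ∈ (uniformBall (Fin n) (Fin k) r).filter
      (fun A => (A.map (Int.cast : ℤ → ℚ)).rank = n),
    (greatestDivisor A : ℝ) ^ (-(m : ℤ))

/-! A system is solvable exactly when each of the m columns of its right-hand side lies in the
lattice L generated by the columns of A (`mem_SAT_iff`). Hence A contributes |L ∩ [-r,r]^n|^m
solvable systems. If A has rank n, then L has index g = gcd(A) (`card_quotient_columnLattice`), so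
about 1/g of the cube lies in L and A contributes a proportion of about g^{-m}.

The difficulty is uniformity, since A varies with r (`eventually_abs_latticeBox_density_sub_le`). If
g is at most a fixed T, every coset of L has a representative of size at most T, a negligible shift
of the cube. If g > T, only smallness is needed: entries of A bounded by r give representatives of
size at most n * r, so the proportion is at most (n+1)^n / g, and both it and 1/g are small.

Matrices of deficient rank have proportion O(1/r) (`exists_card_rank_ne_le`), and replacing 2r+1 by
2r does not affect the limit. -/

/-! ### Rank, minors and small coset representatives -/

/-- The subgroup of `ℤ^n` generated by the columns of an integer matrix. -/
abbrev columnLattice {n k : ℕ} (A : Matrix (Fin n) (Fin k) ℤ) : Submodule ℤ (Fin n → ℤ) :=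
  LinearMap.range A.mulVecLin

theorem exists_det_submatrix_ne_zero {n k : ℕ} {A : Matrix (Fin n) (Fin k) ℤ}
    (hA : (A.map (Int.cast : ℤ → ℚ)).rank = n) :
    ∃ f : Fin n → Fin k, (A.submatrix id f).det ≠ 0 := by
  set A' := A.map (Int.cast : ℤ → ℚ) with hA'
  obtain ⟨κ, a, ha, hspan, hli⟩ := exists_linearIndependent' ℚ A'.col
  have : Fintype κ := Fintype.ofInjective a ha
  have hcard : Fintype.card κ = n := by
    rw [linearIndependent_iff_card_eq_finrank_span.mp hli, Set.finrank, hspan,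
      ← Matrix.rank_eq_finrank_span_cols, hA]
  let e : Fin n ≃ κ := (Fintype.equivFinOfCardEq hcard).symm
  refine ⟨a ∘ e, fun h0 => ?_⟩
  have hu : IsUnit (A'.submatrix id (a ∘ e)) := by
    rw [← Matrix.linearIndependent_cols_iff_isUnit]
    exact hli.comp e e.injective
  rw [Matrix.isUnit_iff_isUnit_det, isUnit_iff_ne_zero] at hu
  apply hu
  have : A'.submatrix id (a ∘ e) = (A.submatrix id (a ∘ e)).map (Int.castRingHom ℚ) := rfl
  rw [this, ← RingHom.mapMatrix_apply, ← RingHom.map_det, h0, map_zero]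

theorem rank_eq_of_det_submatrix_ne_zero {n k : ℕ} {A : Matrix (Fin n) (Fin k) ℤ}
    {f : Fin n → Fin k} (hf : (A.submatrix id f).det ≠ 0) :
    (A.map (Int.cast : ℤ → ℚ)).rank = n := by
  refine le_antisymm ((Matrix.rank_le_card_height _).trans (by simp)) ?_
  have hu : IsUnit ((A.map (Int.cast : ℤ → ℚ)).submatrix id f) := by
    rw [Matrix.isUnit_iff_isUnit_det, isUnit_iff_ne_zero]
    have : (A.map (Int.cast : ℤ → ℚ)).submatrix id f =
      (A.submatrix id f).map (Int.castRingHom ℚ) := rfl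
    rw [this, ← RingHom.mapMatrix_apply, ← RingHom.map_det]
    simpa using hf
  have h := Matrix.rank_of_isUnit _ hu
  rw [Fintype.card_fin] at h
  calc n = _ := h.symm
    _ ≤ _ := Matrix.rank_submatrix_le _ _ _

/-- Division with remainder by a nonsingular matrix of bounded columns: every coset of the column
lattice has a small representative. -/
theorem exists_small_sub_mem_columnLattice {n k r : ℕ} {A : Matrix (Fin n) (Fin k) ℤ}
    (hA : (A.map (Int.cast : ℤ → ℚ)).rank = n) (hr : ∀ i j, |A i j| ≤ r) (x : Fin n → ℤ) :
    ∃ z : Fin n → ℤ, (∀ i, |z i| ≤ (n * r : ℕ)) ∧ x - z ∈ columnLattice A := by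
  obtain ⟨f, hf⟩ := exists_det_submatrix_ne_zero hA
  set M := A.submatrix id f with hM
  set d := M.det with hd
  set y := M.adjugate.mulVec x with hy
  have hMy : M.mulVec y = d • x := by
    rw [hy, Matrix.mulVec_mulVec, Matrix.mul_adjugate, Matrix.smul_mulVec, Matrix.one_mulVec]
  -- Rounding M⁻¹x = y / d down to q leaves z = x - Mq with d * z = M s and 0 ≤ s j < |d|; the
  -- factor |d| cancels from the bound.
  let q : Fin n → ℤ := fun i => y i / d
  let s : Fin n → ℤ := fun i => y i % d
  have hys : y = d • q + s := by
    ext i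
    simp [q, s, Int.mul_ediv_add_emod]
  refine ⟨x - M.mulVec q, fun i => ?_, ?_⟩
  · have hz : d * (x - M.mulVec q) i = M.mulVec s i := by
      have h := congrFun hMy i
      rw [hys, Matrix.mulVec_add, Matrix.mulVec_smul] at h
      simp only [Pi.add_apply, Pi.smul_apply, smul_eq_mul] at h
      rw [Pi.sub_apply]
      linarith
    have hb : |d| * |(x - M.mulVec q) i| ≤ |d| * (n * r : ℕ) := by
      rw [← abs_mul, hz, Matrix.mulVec, dotProduct]
      calc |∑ j, M i j * s j| ≤ ∑ j, |M i j * s j| := Finset.abs_sum_le_sum_abs _ _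
        _ ≤ ∑ _j : Fin n, (r : ℤ) * |d| := by
          refine Finset.sum_le_sum fun j _ => ?_
          rw [abs_mul]
          refine mul_le_mul (hr _ _) ?_ (abs_nonneg _) (by positivity)
          rw [abs_of_nonneg (Int.emod_nonneg _ hf)]
          exact (Int.emod_lt_abs _ hf).le
        _ = |d| * (n * r : ℕ) := by
          simp; ring
    exact le_of_mul_le_mul_left hb (abs_pos.mpr hf)
  · rw [sub_sub_cancel]
    have : ∀ j, M.col j ∈ columnLattice A := fun j =>
      ⟨Pi.single (f j) 1, by simp [hM]; rfl⟩
    rw [Matrix.mulVec_eq_sum]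
    exact Submodule.sum_mem _ fun j _ => by
      have h := Submodule.smul_mem _ (q j) (this j)
      rwa [← op_smul_eq_smul] at h

theorem finite_quotient_columnLattice {n k : ℕ} {A : Matrix (Fin n) (Fin k) ℤ}
    (hA : (A.map (Int.cast : ℤ → ℚ)).rank = n) : Finite ((Fin n → ℤ) ⧸ columnLattice A) := by
  let r : ℕ := uniformLength A
  have hr : ∀ i j, |A i j| ≤ r := fun i j => by
    have h : (A i j).natAbs ≤ r :=
      (Finset.le_sup (f := fun j => (A i j).natAbs) (Finset.mem_univ j)).trans
        (Finset.le_sup (f := fun i => Finset.univ.sup fun j => (A i j).natAbs) (Finset.mem_univ i))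
    rw [Int.abs_eq_natAbs]
    exact_mod_cast h
  have hfin : Set.Finite (Set.pi Set.univ fun _ : Fin n =>
      Set.Icc (-((n * r : ℕ) : ℤ)) ((n * r : ℕ) : ℤ)) :=
    Set.Finite.pi fun _ => Set.finite_Icc _ _
  refine Set.finite_univ_iff.mp ((hfin.image (columnLattice A).mkQ).subset fun q _ => ?_)
  obtain ⟨x, rfl⟩ := Submodule.mkQ_surjective _ q
  obtain ⟨z, hz, hxz⟩ := exists_small_sub_mem_columnLattice hA hr x
  refine ⟨z, fun i _ => abs_le.mp (hz i), ?_⟩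
  simp only [Submodule.mkQ_apply]
  exact ((Submodule.Quotient.eq _).mpr hxz).symm

/-! ### The greatest divisor as a lattice index -/

/-- The expansion of the determinant of a product along the columns of the first factor. -/
theorem dvd_det_mul_of_forall_dvd_det_submatrix {n k : ℕ} {C : Matrix (Fin n) (Fin k) ℤ}
    (D : Matrix (Fin k) (Fin n) ℤ) {g : ℤ}
    (h : ∀ f : Fin n ↪o Fin k, g ∣ (C.submatrix id f).det) : g ∣ (C * D).det := by
  -- The expansion below runs over all maps: an injective one gives a minor up to sign, any other a
  -- repeated column.
  have hall : ∀ f : Fin n → Fin k, g ∣ (C.submatrix id f).det := by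
    intro f
    by_cases hf : Function.Injective f
    · let σ := Tuple.sort f
      have hmono : StrictMono (f ∘ σ) :=
        (Tuple.monotone_sort f).strictMono_of_injective (hf.comp σ.injective)
      have h1 := h (OrderEmbedding.ofStrictMono _ hmono)
      have h2 : (C.submatrix id (OrderEmbedding.ofStrictMono _ hmono)) =
          (C.submatrix id f).submatrix id σ := rfl
      rw [h2, Matrix.det_permute'] at h1
      exact (IsUnit.dvd_mul_left (Units.isUnit (Equiv.Perm.sign σ) |>.map (Int.castRingHom ℤ))).mp
        (by simpa using h1)
    · simp only [Function.Injective, not_forall] at hf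
      obtain ⟨i, j, hij, hne⟩ := hf
      rw [Matrix.det_zero_of_column_eq hne fun l => by simp [hij]]
      exact dvd_zero _
  have hexp : (C * D).det = ∑ p : Fin n → Fin k,
      (∏ i, D (p i) i) * (C.submatrix id p).det := by
    simp only [Matrix.det_apply', Matrix.mul_apply, Finset.prod_univ_sum, Finset.mul_sum,
      Fintype.piFinset_univ]
    rw [Finset.sum_comm]
    refine Finset.sum_congr rfl fun p _ => Finset.sum_congr rfl fun σ _ => ?_
    rw [Finset.prod_mul_distrib]
    simp only [Matrix.submatrix_apply, id]
    ring
  rw [hexp]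
  exact Finset.dvd_sum fun p _ => (hall p).mul_left _

/-- A common divisor of the minors of C divides det(CD) = 1. -/
theorem greatestDivisor_eq_one_of_mul_eq_one {n k : ℕ} {C : Matrix (Fin n) (Fin k) ℤ}
    {D : Matrix (Fin k) (Fin n) ℤ} (h : C * D = 1) : greatestDivisor C = 1 := by
  have := dvd_det_mul_of_forall_dvd_det_submatrix (C := C) D (g := greatestDivisor C) fun f =>
    Int.natCast_dvd.mpr (Finset.gcd_dvd (Finset.mem_univ f))
  rw [h, Matrix.det_one] at this
  exact Nat.dvd_one.mp (by exact_mod_cast this)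

theorem greatestDivisor_mul {n k : ℕ} (B : Matrix (Fin n) (Fin n) ℤ)
    (C : Matrix (Fin n) (Fin k) ℤ) :
    greatestDivisor (B * C) = B.det.natAbs * greatestDivisor C := by
  have (f : Fin n ↪o Fin k) : ((B * C).submatrix id f).det.natAbs =
      B.det.natAbs * (C.submatrix id f).det.natAbs := by
    have h : (B * C).submatrix id f = B * C.submatrix id f := rfl
    rw [h, Matrix.det_mul, Int.natAbs_mul]
  simp only [greatestDivisor, this, Finset.gcd_mul_left, normalize_eq]

/-- The greatest divisor of a matrix of full row rank is the index of its column lattice. -/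
theorem card_quotient_columnLattice {n k : ℕ} {A : Matrix (Fin n) (Fin k) ℤ}
    (hA : (A.map (Int.cast : ℤ → ℚ)).rank = n) :
    Nat.card ((Fin n → ℤ) ⧸ columnLattice A) = greatestDivisor A := by
  have := finite_quotient_columnLattice hA
  have hrank : Module.finrank ℤ (columnLattice A) = n := by
    refine le_antisymm ((Submodule.finrank_le _).trans (by simp)) ?_
    obtain ⟨f, hf⟩ := exists_det_submatrix_ne_zero hA
    have hli := LinearIndependent.of_comp (columnLattice A).subtype
      (v := fun j => ⟨(A.submatrix id f).col j, Pi.single (f j) 1, by simp; rfl⟩)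
      (Matrix.linearIndependent_cols_of_det_ne_zero hf)
    simpa using hli.fintype_card_le_finrank
  -- Factor A = BC with the columns of B a basis of the lattice. These are in turn combinations AD
  -- of the columns of A, and cancelling B gives CD = 1. So gcd(A) = |det B|, which is the index.
  let b : Module.Basis (Fin n) ℤ (columnLattice A) := Module.finBasisOfFinrankEq ℤ _ hrank
  let B : Matrix (Fin n) (Fin n) ℤ := Matrix.of fun i j => (b j : Fin n → ℤ) i
  have hB (v : Fin n → ℤ) : B.mulVec v = ((∑ j, v j • b j : columnLattice A) : Fin n → ℤ) := by
    ext i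
    simp [B, Matrix.mulVec, dotProduct, mul_comm]
  have hAmem (j : Fin k) : A.col j ∈ columnLattice A := ⟨Pi.single j 1, by simp⟩
  let C : Matrix (Fin n) (Fin k) ℤ := Matrix.of fun i j => b.repr ⟨A.col j, hAmem j⟩ i
  have hBC : A = B * C := by
    ext i j
    have h := congrArg (fun v : columnLattice A => (v : Fin n → ℤ) i)
      (b.sum_repr ⟨A.col j, hAmem j⟩)
    simp only at h
    have h2 := congrFun (hB (fun l => C l j)) i
    exact (h2.trans h).symm
  have hBinj : Function.Injective B.mulVec := by
    intro v w hvw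
    rw [hB, hB] at hvw
    have h := congrArg (fun u => ⇑(b.repr u)) (Subtype.ext hvw)
    simpa only [b.repr_sum_self] using h
  have hD : ∀ i : Fin n, ∃ x : Fin k → ℤ, A.mulVec x = b i := fun i => (b i).2
  choose x hx using hD
  let D : Matrix (Fin k) (Fin n) ℤ := Matrix.of fun i j => x j i
  have hCD : C * D = 1 := by
    have hAD : A * D = B := by
      ext i j
      exact congrFun (hx j) i
    rw [hBC, Matrix.mul_assoc] at hAD
    ext i j
    have : B.mulVec ((C * D).col j) = B.mulVec ((1 : Matrix (Fin n) (Fin n) ℤ).col j) := by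
      rw [← Matrix.mulVec_single_one, ← Matrix.mulVec_single_one, Matrix.mulVec_mulVec, hAD,
        Matrix.mulVec_mulVec, mul_one]
    exact congrFun (hBinj this) i
  have hdet := Submodule.natAbs_det_basis_change (Pi.basisFun ℤ (Fin n)) (columnLattice A) b
  have hBdet : (Pi.basisFun ℤ (Fin n)).det ((↑) ∘ b) = B.det := by
    rw [Module.Basis.det_apply]
    congr 1
  rw [← hdet, hBdet, hBC, greatestDivisor_mul, greatestDivisor_eq_one_of_mul_eq_one hCD, mul_one]

/-! ### Lattice points in cubes -/

/-- The integer points of the cube `[-r, r]^n`. -/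
noncomputable def intBox (n r : ℕ) : Finset (Fin n → ℤ) :=
  Fintype.piFinset fun _ => Finset.Icc (-(r : ℤ)) (r : ℤ)

theorem mem_intBox {n r : ℕ} {x : Fin n → ℤ} : x ∈ intBox n r ↔ ∀ i, |x i| ≤ r := by
  simp [intBox, abs_le]

theorem card_intBox (n r : ℕ) : (intBox n r).card = (2 * r + 1) ^ n := by
  rw [intBox, Fintype.card_piFinset_const, Int.card_Icc]
  congr 1
  omega

theorem add_mem_intBox {n r s : ℕ} {x y : Fin n → ℤ} (hx : x ∈ intBox n r) (hy : y ∈ intBox n s) :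
    x + y ∈ intBox n (r + s) := by
  rw [mem_intBox] at *
  intro i
  push_cast
  exact (abs_add_le _ _).trans (add_le_add (hx i) (hy i))

theorem sub_mem_intBox {n r s : ℕ} {x y : Fin n → ℤ} (hx : x ∈ intBox n r) (hy : y ∈ intBox n s) :
    x - y ∈ intBox n (r + s) := by
  rw [mem_intBox] at *
  intro i
  push_cast
  exact (abs_sub (x i) (y i)).trans (add_le_add (hx i) (hy i))

open Classical in
/-- The points of a subgroup of `ℤ^n` in the cube `[-r, r]^n`. -/
noncomputable def latticeBox {n : ℕ} (L : Submodule ℤ (Fin n → ℤ)) (r : ℕ) :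
    Finset (Fin n → ℤ) :=
  (intBox n r).filter (· ∈ L)

theorem mem_latticeBox {n r : ℕ} {L : Submodule ℤ (Fin n → ℤ)} {x : Fin n → ℤ} :
    x ∈ latticeBox L r ↔ x ∈ intBox n r ∧ x ∈ L := by
  classical simp [latticeBox]

section Cosets

variable {n R : ℕ} {L : Submodule ℤ (Fin n → ℤ)} [Finite ((Fin n → ℤ) ⧸ L)]

/-- Translation by a small representative z injects the lattice points of the cube into each coset
within the cube enlarged by R; sum over cosets. -/
theorem card_quotient_mul_card_latticeBox_le
    (hR : ∀ x, ∃ z ∈ intBox n R, x - z ∈ L) (r : ℕ) :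
    Nat.card ((Fin n → ℤ) ⧸ L) * (latticeBox L r).card ≤ (2 * (r + R) + 1) ^ n := by
  classical
  have := Fintype.ofFinite ((Fin n → ℤ) ⧸ L)
  rw [← card_intBox, Finset.card_eq_sum_card_fiberwise (s := intBox n (r + R)) (f := L.mkQ) (t := Finset.univ)
    fun _ _ => Finset.mem_coe.mpr (Finset.mem_univ _), Nat.card_eq_fintype_card,
    ← Finset.card_univ, ← smul_eq_mul]
  refine Finset.card_nsmul_le_sum _ _ _ fun q _ => ?_
  obtain ⟨x, rfl⟩ := L.mkQ_surjective q
  obtain ⟨z, hz, hxz⟩ := hR x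
  refine Finset.card_le_card_of_injOn (fun y => y + z) (fun y hy => ?_)
    fun a _ b _ h => add_right_cancel h
  rw [Finset.mem_coe, mem_latticeBox] at hy
  rw [Finset.mem_coe, Finset.mem_filter]
  refine ⟨add_mem_intBox hy.1 hz, ?_⟩
  rw [Submodule.mkQ_apply, Submodule.mkQ_apply, Submodule.Quotient.eq]
  have : y + z - x = y - (x - z) := by abel
  rw [this]
  exact L.sub_mem hy.2 hxz

/-- The reverse translation: subtracting z moves each coset back into L. -/
theorem le_card_quotient_mul_card_latticeBox
    (hR : ∀ x, ∃ z ∈ intBox n R, x - z ∈ L) (r : ℕ) :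
    (2 * r + 1) ^ n ≤ Nat.card ((Fin n → ℤ) ⧸ L) * (latticeBox L (r + R)).card := by
  classical
  have := Fintype.ofFinite ((Fin n → ℤ) ⧸ L)
  rw [← card_intBox, Finset.card_eq_sum_card_fiberwise (f := L.mkQ) (t := Finset.univ)
    fun _ _ => Finset.mem_coe.mpr (Finset.mem_univ _), Nat.card_eq_fintype_card,
    ← Finset.card_univ, ← smul_eq_mul]
  refine Finset.sum_le_card_nsmul _ _ _ fun q _ => ?_
  obtain ⟨x, rfl⟩ := L.mkQ_surjective q
  obtain ⟨z, hz, hxz⟩ := hR x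
  refine Finset.card_le_card_of_injOn (fun y => y - z) (fun y hy => ?_)
    fun a _ b _ h => sub_left_injective h
  rw [Finset.mem_coe, Finset.mem_filter] at hy
  rw [Finset.mem_coe, mem_latticeBox]
  refine ⟨sub_mem_intBox hy.1 hz, ?_⟩
  have h := hy.2
  rw [Submodule.mkQ_apply, Submodule.mkQ_apply, Submodule.Quotient.eq] at h
  simpa using L.add_mem h hxz

/-- The quotient is killed by its order g, so coordinates may be reduced mod g. The bound depends on
the index alone. -/
theorem exists_mem_intBox_card_quotient (x : Fin n → ℤ) :
    ∃ z ∈ intBox n (Nat.card ((Fin n → ℤ) ⧸ L)), x - z ∈ L := by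
  set g := Nat.card ((Fin n → ℤ) ⧸ L) with hg
  have hpos : (0 : ℤ) < g := by exact_mod_cast Nat.card_pos
  refine ⟨fun i => x i % g, mem_intBox.mpr fun i => ?_, ?_⟩
  · rw [abs_of_nonneg (Int.emod_nonneg _ hpos.ne')]
    exact (Int.emod_lt_of_pos _ hpos).le
  · have h : x - (fun i => x i % (g : ℤ)) = g • fun i => x i / (g : ℤ) := by
      ext i
      have := Int.mul_ediv_add_emod (x i) g
      simp only [Pi.sub_apply, Pi.smul_apply, nsmul_eq_mul]
      linarith
    rw [h, ← Submodule.Quotient.mk_eq_zero, Submodule.Quotient.mk_smul, hg]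
    exact card_nsmul_eq_zero'

end Cosets

/-! ### Counting solvable systems and rank-deficient matrices -/

theorem card_uniformBall (p q : Type*) [Fintype p] [DecidableEq p] [Fintype q] [DecidableEq q]
    (r : ℕ) : (uniformBall p q r).card = (2 * r + 1) ^ (Fintype.card p * Fintype.card q) := by
  simp only [uniformBall, Finset.card_map, Fintype.card_piFinset, Int.card_Icc, Finset.prod_const,
    Finset.card_univ, ← pow_mul, mul_comm (Fintype.card p)]
  congr 1
  omega

theorem mem_uniformBall_iff_forall_abs_le {p q : Type*} [Fintype p] [DecidableEq p] [Fintype q]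
    [DecidableEq q] {r : ℕ} {M : Matrix p q ℤ} : M ∈ uniformBall p q r ↔ ∀ i j, |M i j| ≤ r := by
  simp only [uniformBall, Finset.mem_map_equiv, Fintype.mem_piFinset, Finset.mem_Icc, abs_le]
  rfl

theorem mem_SAT_iff {m k n : ℕ} {S : LinSystem m k n} :
    S ∈ SAT m k n ↔ ∀ l, (fun i => S i (Sum.inr l)) ∈
      columnLattice (Matrix.of fun i j => S i (Sum.inl j)) := by
  constructor
  · rintro ⟨x, hx⟩ l
    refine ⟨fun j => x j l, funext fun i => ?_⟩
    simpa [Matrix.mulVec, dotProduct] using congrFun (hx i) l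
  · intro h
    choose x hx using h
    refine ⟨fun j l => x l j, fun i => funext fun l => ?_⟩
    simpa [Matrix.mulVec, dotProduct] using congrFun (hx l) i

/-- The solvable systems in a ball, counted by their coefficient matrices. -/
theorem ncard_SAT_inter_uniformBall (m k n r : ℕ) :
    (SAT m k n ∩ (uniformBall (Fin n) (Fin k ⊕ Fin m) r : Set (LinSystem m k n))).ncard =
      ∑ A ∈ uniformBall (Fin n) (Fin k) r, (latticeBox (columnLattice A) r).card ^ m := by
  classical
  have h : SAT m k n ∩ (uniformBall (Fin n) (Fin k ⊕ Fin m) r : Set (LinSystem m k n)) =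
      ((uniformBall (Fin n) (Fin k ⊕ Fin m) r).filter (· ∈ SAT m k n) :
        Set (LinSystem m k n)) := by
    ext S
    simp [and_comm]
  rw [h, Set.ncard_coe_finset]
  have h2 : ∑ A ∈ uniformBall (Fin n) (Fin k) r, (latticeBox (columnLattice A) r).card ^ m =
      ((uniformBall (Fin n) (Fin k) r).sigma fun A =>
        Fintype.piFinset fun _ : Fin m => latticeBox (columnLattice A) r).card := by
    simp [Finset.card_sigma]
  rw [h2]
  refine Finset.card_bij'
    (fun S _ => ⟨Matrix.of fun i j => S i (Sum.inl j), fun l i => S i (Sum.inr l)⟩)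
    (fun p _ => Matrix.of fun i => Sum.elim (p.1 i) fun l => p.2 l i) ?_ ?_ ?_ ?_
  · intro S hS
    rw [Finset.mem_filter, mem_uniformBall_iff_forall_abs_le, mem_SAT_iff] at hS
    simp only [Finset.mem_sigma, mem_uniformBall_iff_forall_abs_le, Fintype.mem_piFinset,
      mem_latticeBox, mem_intBox]
    exact ⟨fun i j => hS.1 i _, fun l => ⟨fun i => hS.1 i _, hS.2 l⟩⟩
  · rintro ⟨A, b⟩ hp
    simp only [Finset.mem_sigma, mem_uniformBall_iff_forall_abs_le, Fintype.mem_piFinset,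
      mem_latticeBox, mem_intBox] at hp
    rw [Finset.mem_filter, mem_uniformBall_iff_forall_abs_le, mem_SAT_iff]
    refine ⟨fun i j => ?_, fun l => (hp.2 l).2⟩
    cases j with
    | inl j => exact hp.1 i j
    | inr l => exact (hp.2 l).1 i
  · intro S _
    ext i j
    cases j <;> rfl
  · intro p _
    rfl

/-- Few integer matrices have deficient row rank, by the Schwartz–Zippel lemma. -/
theorem exists_card_rank_ne_le {n k : ℕ} (hnk : n ≤ k) : ∃ C : ℕ, ∀ r : ℕ,
    (((uniformBall (Fin n) (Fin k) r).filter
      (fun A => ¬ (A.map (Int.cast : ℤ → ℚ)).rank = n)).card : ℝ) / (2 * r + 1) ^ (n * k) ≤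
        C / (2 * r + 1) := by
  classical
  -- The minor on the first n columns suffices: it vanishes at every deficient matrix and is a
  -- nonzero polynomial in the n * k entries.
  let P : MvPolynomial (Fin n × Fin n) ℤ := (Matrix.mvPolynomialX (Fin n) (Fin n) ℤ).det
  let ι : Fin n × Fin n → Fin n × Fin k := Prod.map id (Fin.castLE hnk)
  have hι : Function.Injective ι := Function.injective_id.prodMap (Fin.castLE_injective hnk)
  let e : Fin n × Fin k ≃ Fin (n * k) := finProdFinEquiv
  let Q : MvPolynomial (Fin (n * k)) ℤ := MvPolynomial.rename (e ∘ ι) P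
  have hQ : Q ≠ 0 := by
    rw [Ne, map_eq_zero_iff _ (MvPolynomial.rename_injective _ (e.injective.comp hι))]
    exact Matrix.det_mvPolynomialX_ne_zero _ _
  refine ⟨Q.totalDegree, fun r => ?_⟩
  have hsz := MvPolynomial.schwartz_zippel_totalDegree hQ (Finset.Icc (-(r : ℤ)) r)
  have hcard : (Finset.Icc (-(r : ℤ)) r).card = 2 * r + 1 := by
    rw [Int.card_Icc]; omega
  rw [hcard] at hsz
  have hle : ((uniformBall (Fin n) (Fin k) r).filter
      (fun A => ¬ (A.map (Int.cast : ℤ → ℚ)).rank = n)).card ≤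
      {f ∈ Fintype.piFinset fun _ : Fin (n * k) => Finset.Icc (-(r : ℤ)) r |
        MvPolynomial.eval f Q = 0}.card := by
    refine Finset.card_le_card_of_injOn (fun A x => A (e.symm x).1 (e.symm x).2) ?_ ?_
    · intro A hA
      rw [Finset.mem_coe, Finset.mem_filter, mem_uniformBall_iff_forall_abs_le] at hA
      rw [Finset.mem_coe, Finset.mem_filter]
      refine ⟨Fintype.mem_piFinset.mpr fun x => Finset.mem_Icc.mpr (abs_le.mp (hA.1 _ _)), ?_⟩
      rw [MvPolynomial.eval_rename, Matrix.eval_det_mvPolynomialX]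
      by_contra h0
      refine hA.2 (rank_eq_of_det_submatrix_ne_zero (f := Fin.castLE hnk) ?_)
      convert h0 using 2
      ext i j
      simp [ι]
    · intro A _ B _ h
      ext i j
      simpa using congrFun h (e (i, j))
  have hsz' : (({f ∈ Fintype.piFinset fun _ : Fin (n * k) => Finset.Icc (-(r : ℤ)) r |
        MvPolynomial.eval f Q = 0}.card : ℝ)) / (2 * r + 1) ^ (n * k) ≤
      Q.totalDegree / (2 * r + 1) := by
    have := (NNRat.cast_le (K := ℝ)).mpr hsz
    push_cast at this
    exact this
  refine le_trans ?_ hsz'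
  gcongr

/-! ### Uniform density of the column lattices -/

theorem tendsto_two_mul_add_div_pow (c : ℝ) (N : ℕ) :
    Tendsto (fun r : ℕ => ((2 * (r : ℝ) + c) / (2 * r + 1)) ^ N) atTop (𝓝 1) := by
  have h1 : Tendsto (fun r : ℕ => 2 * (r : ℝ) + 1) atTop atTop :=
    tendsto_atTop_add_const_right _ _ (tendsto_natCast_atTop_atTop.const_mul_atTop two_pos)
  have h2 : Tendsto (fun r : ℕ => 1 + (c - 1) / (2 * (r : ℝ) + 1)) atTop (𝓝 (1 + 0)) :=
    tendsto_const_nhds.add (h1.const_div_atTop _)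
  have h3 := h2.pow N
  rw [add_zero, one_pow] at h3
  refine h3.congr fun r => ?_
  have : (2 * (r : ℝ) + 1) ≠ 0 := by positivity
  congr 1
  field_simp
  ring

/-- Carries the density estimate from one column of the right-hand side to all m. -/
theorem abs_pow_sub_pow_le_mul_abs_sub {u v : ℝ} (hu : 0 ≤ u) (hu1 : u ≤ 1) (hv : 0 ≤ v)
    (hv1 : v ≤ 1) (m : ℕ) : |u ^ m - v ^ m| ≤ m * |u - v| := by
  induction m with
  | zero => simp
  | succ m ih =>
    have h : u ^ (m + 1) - v ^ (m + 1) = u * (u ^ m - v ^ m) + v ^ m * (u - v) := by ring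
    calc |u ^ (m + 1) - v ^ (m + 1)| ≤ |u * (u ^ m - v ^ m)| + |v ^ m * (u - v)| := by
          rw [h]; exact abs_add_le _ _
      _ = u * |u ^ m - v ^ m| + v ^ m * |u - v| := by
          rw [abs_mul, abs_mul, abs_of_nonneg hu, abs_of_nonneg (pow_nonneg hv m)]
      _ ≤ 1 * (m * |u - v|) + 1 * |u - v| := by
          gcongr
          exact pow_le_one₀ hv hv1
      _ = _ := by push_cast; ring

/-- The proportion of the points of the column lattice in a large cube is uniformly close to the
inverse of its index. -/
theorem eventually_abs_latticeBox_density_sub_le (k n : ℕ) {ε : ℝ} (hε : 0 < ε) :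
    ∀ᶠ r : ℕ in atTop, ∀ A ∈ uniformBall (Fin n) (Fin k) r,
      (A.map (Int.cast : ℤ → ℚ)).rank = n →
        |((latticeBox (columnLattice A) r).card : ℝ) / (2 * r + 1) ^ n -
          (greatestDivisor A : ℝ)⁻¹| ≤ ε := by
  -- Index above T forces (n+1)^n / g ≤ ε.
  obtain ⟨T, hT⟩ := exists_nat_gt (((n : ℝ) + 1) ^ n / ε)
  have hup := (tendsto_two_mul_add_div_pow (2 * T + 1) n).eventually
    (eventually_le_nhds (lt_add_of_pos_right 1 hε))
  have hlow := (tendsto_two_mul_add_div_pow (-2 * T + 1) n).eventually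
    (eventually_ge_nhds (sub_lt_self 1 hε))
  filter_upwards [hup, hlow, eventually_ge_atTop T] with r hup hlow hrT A hA hrank
  have := finite_quotient_columnLattice hrank
  have hcard := card_quotient_columnLattice hrank
  set g := greatestDivisor A with hg
  have hg0 : 0 < g := by rw [← hcard]; exact Nat.card_pos
  have hg0' : (0 : ℝ) < g := by exact_mod_cast hg0
  set N := (latticeBox (columnLattice A) r).card with hN
  have hs : (0 : ℝ) < (2 * r + 1) ^ n := by positivity
  rcases le_or_gt g T with hgT | hgT
  · have hR : ∀ x, ∃ z ∈ intBox n g, x - z ∈ columnLattice A := fun x => by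
      rw [← hcard]
      exact exists_mem_intBox_card_quotient x
    have h1 := card_quotient_mul_card_latticeBox_le hR r
    have h2 := le_card_quotient_mul_card_latticeBox hR (r - g)
    rw [hcard, ← hN] at h1
    rw [Nat.sub_add_cancel (hgT.trans hrT), hcard, ← hN] at h2
    have hgT' : (g : ℝ) ≤ T := by exact_mod_cast hgT
    have hrT' : (T : ℝ) ≤ r := by exact_mod_cast hrT
    have h1' : (g : ℝ) * N ≤ (2 * r + (2 * T + 1)) ^ n := by
      have : (g : ℝ) * N ≤ (2 * (r + g) + 1) ^ n := by exact_mod_cast h1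
      refine this.trans (pow_le_pow_left₀ (by positivity) ?_ n)
      linarith
    have h2' : (2 * (r : ℝ) + (-2 * T + 1)) ^ n ≤ (g : ℝ) * N := by
      have : (2 * ((r - g : ℕ) : ℝ) + 1) ^ n ≤ g * N := by exact_mod_cast h2
      rw [Nat.cast_sub (hgT.trans hrT)] at this
      refine le_trans (pow_le_pow_left₀ ?_ ?_ n) this <;> linarith
    have hx : |(g : ℝ) * N / (2 * r + 1) ^ n - 1| ≤ ε := by
      rw [abs_le]
      rw [div_pow] at hup hlow
      have := div_le_div_of_nonneg_right h1' hs.le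
      have := div_le_div_of_nonneg_right h2' hs.le
      constructor <;> linarith
    have heq : (N : ℝ) / (2 * r + 1) ^ n - (g : ℝ)⁻¹ =
        (g : ℝ)⁻¹ * (g * N / (2 * r + 1) ^ n - 1) := by
      field_simp
    rw [heq, abs_mul, abs_of_pos (inv_pos.mpr hg0')]
    have : (g : ℝ)⁻¹ ≤ 1 := inv_le_one_of_one_le₀ (by exact_mod_cast hg0)
    calc _ ≤ 1 * ε := by gcongr
      _ = ε := one_mul ε
  · have hR : ∀ x, ∃ z ∈ intBox n (n * r), x - z ∈ columnLattice A := fun x => by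
      obtain ⟨z, hz, hxz⟩ := exists_small_sub_mem_columnLattice hrank
        (mem_uniformBall_iff_forall_abs_le.mp hA) x
      exact ⟨z, mem_intBox.mpr hz, hxz⟩
    have h1 := card_quotient_mul_card_latticeBox_le hR r
    rw [hcard, ← hN] at h1
    have h1' : (g : ℝ) * N ≤ ((n + 1) * (2 * r + 1)) ^ n := by
      have : (g : ℝ) * N ≤ (2 * (r + n * r) + 1) ^ n := by exact_mod_cast h1
      refine this.trans (pow_le_pow_left₀ (by positivity) ?_ n)
      nlinarith [Nat.cast_nonneg (α := ℝ) n]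
    have hgε : ((n : ℝ) + 1) ^ n / g ≤ ε := by
      rw [div_le_iff₀ hg0']
      rw [div_lt_iff₀ hε] at hT
      have : (T : ℝ) ≤ g := by exact_mod_cast hgT.le
      nlinarith
    have hu : (N : ℝ) / (2 * r + 1) ^ n ≤ ε := by
      refine le_trans ?_ hgε
      rw [div_le_div_iff₀ hs hg0', ← mul_pow]
      linarith
    have hv : (g : ℝ)⁻¹ ≤ ε := by
      refine le_trans ?_ hgε
      rw [inv_eq_one_div]
      gcongr
      exact one_le_pow₀ (by linarith [Nat.cast_nonneg (α := ℝ) n])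
    have hu0 : 0 ≤ (N : ℝ) / (2 * r + 1) ^ n := by positivity
    have hv0 : 0 ≤ (g : ℝ)⁻¹ := by positivity
    rw [abs_le]
    constructor <;> linarith

theorem latticeBox_density_le_one {n : ℕ} (L : Submodule ℤ (Fin n → ℤ)) (r : ℕ) :
    ((latticeBox L r).card : ℝ) / (2 * r + 1) ^ n ≤ 1 := by
  classical
  rw [div_le_one (by positivity)]
  have h : (latticeBox L r).card ≤ (2 * r + 1) ^ n := by
    rw [← card_intBox]
    exact Finset.card_filter_le _ _
  exact_mod_cast h

/-! ### Comparison of the density with the gcd sum -/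

theorem ncard_SAT_div_card (m k n r : ℕ) :
    ((SAT m k n ∩ (uniformBall (Fin n) (Fin k ⊕ Fin m) r : Set (LinSystem m k n))).ncard : ℝ) /
        ((uniformBall (Fin n) (Fin k ⊕ Fin m) r).card : ℝ) =
      (∑ A ∈ uniformBall (Fin n) (Fin k) r,
        (((latticeBox (columnLattice A) r).card : ℝ) / (2 * r + 1) ^ n) ^ m) /
          (2 * r + 1) ^ (n * k) := by
  rw [ncard_SAT_inter_uniformBall, card_uniformBall, Finset.sum_div, Nat.cast_sum, Finset.sum_div]
  refine Finset.sum_congr rfl fun A _ => ?_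
  rw [div_pow, div_div, ← pow_mul, ← pow_add]
  simp only [Fintype.card_fin, Fintype.card_sum]
  push_cast
  congr 2
  ring

theorem tendsto_density_sub_gcdSum {m k n : ℕ} (hnk : n ≤ k) :
    Tendsto (fun r : ℕ =>
      ((SAT m k n ∩ (uniformBall (Fin n) (Fin k ⊕ Fin m) r : Set (LinSystem m k n))).ncard : ℝ) /
        ((uniformBall (Fin n) (Fin k ⊕ Fin m) r).card : ℝ) -
      gcdSum m k n r / (2 * (r : ℝ) + 1) ^ (n * k)) atTop (𝓝 0) := by
  obtain ⟨C, hC⟩ := exists_card_rank_ne_le hnk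
  rw [Metric.tendsto_atTop']
  suffices h : ∀ ε : ℝ, 0 < ε → ∀ᶠ r : ℕ in atTop,
      |((SAT m k n ∩ (uniformBall (Fin n) (Fin k ⊕ Fin m) r : Set (LinSystem m k n))).ncard : ℝ) /
        ((uniformBall (Fin n) (Fin k ⊕ Fin m) r).card : ℝ) -
      gcdSum m k n r / (2 * (r : ℝ) + 1) ^ (n * k)| < ε by
    intro ε hε
    obtain ⟨N, hN⟩ := eventually_atTop.mp (h ε hε)
    exact ⟨N, fun r hr => by simpa [Real.dist_eq] using hN r hr.le⟩
  intro ε hε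
  -- The m-th power costs a factor m; m + 1 keeps the denominator nonzero when m = 0. Full rank then
  -- costs ε/4 and deficient rank less than ε/2.
  have hδ : 0 < ε / (4 * (m + 1)) := by positivity
  have hdef : ∀ᶠ r : ℕ in atTop, (C : ℝ) / (2 * r + 1) < ε / 2 :=
    (Tendsto.const_div_atTop (tendsto_atTop_add_const_right _ _
      (tendsto_natCast_atTop_atTop.const_mul_atTop two_pos)) _).eventually
        (eventually_lt_nhds (half_pos hε))
  filter_upwards [eventually_abs_latticeBox_density_sub_le k n hδ, hdef] with r hr hdef
  set u : Matrix (Fin n) (Fin k) ℤ → ℝ :=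
    fun A => ((latticeBox (columnLattice A) r).card : ℝ) / (2 * r + 1) ^ n with hu
  have hu0 (A) : 0 ≤ u A := by positivity
  have hu1 (A) : u A ≤ 1 := latticeBox_density_le_one _ r
  have hs : (0 : ℝ) < (2 * r + 1) ^ (n * k) := by positivity
  set G := (uniformBall (Fin n) (Fin k) r).filter
    (fun A => (A.map (Int.cast : ℤ → ℚ)).rank = n) with hG
  set H := (uniformBall (Fin n) (Fin k) r).filter
    (fun A => ¬ (A.map (Int.cast : ℤ → ℚ)).rank = n) with hH
  have hfull : |∑ A ∈ G, (u A ^ m - (greatestDivisor A : ℝ) ^ (-(m : ℤ)))| ≤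
      (2 * r + 1) ^ (n * k) * (ε / 4) := by
    calc _ ≤ ∑ A ∈ G, |u A ^ m - (greatestDivisor A : ℝ) ^ (-(m : ℤ))| :=
          Finset.abs_sum_le_sum_abs _ _
      _ ≤ ∑ _A ∈ G, ε / 4 := by
          refine Finset.sum_le_sum fun A hA => ?_
          rw [hG, Finset.mem_filter] at hA
          have hfin := finite_quotient_columnLattice hA.2
          have hg : 1 ≤ greatestDivisor A := by
            rw [← card_quotient_columnLattice hA.2]
            exact Nat.card_pos
          rw [zpow_neg, zpow_natCast, ← inv_pow]
          calc _ ≤ m * |u A - (greatestDivisor A : ℝ)⁻¹| :=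
                abs_pow_sub_pow_le_mul_abs_sub (hu0 A) (hu1 A) (by positivity)
                  (inv_le_one_of_one_le₀ (by exact_mod_cast hg)) m
            _ ≤ (m + 1) * (ε / (4 * (m + 1))) := by
                gcongr
                · linarith
                · exact hr A hA.1 hA.2
            _ = ε / 4 := by field_simp
      _ = G.card * (ε / 4) := by rw [Finset.sum_const, nsmul_eq_mul]
      _ ≤ _ := by
          gcongr
          have h : G.card ≤ (2 * r + 1) ^ (n * k) := by
            have := card_uniformBall (Fin n) (Fin k) r
            rw [Fintype.card_fin, Fintype.card_fin] at this
            rw [← this]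
            exact Finset.card_filter_le _ _
          exact_mod_cast h
  have hdeficient : |∑ A ∈ H, u A ^ m| ≤ H.card := by
    rw [abs_of_nonneg (Finset.sum_nonneg fun A _ => pow_nonneg (hu0 A) m)]
    simpa using Finset.sum_le_sum fun A (_ : A ∈ H) => pow_le_one₀ (n := m) (hu0 A) (hu1 A)
  have hsplit : ∑ A ∈ uniformBall (Fin n) (Fin k) r, u A ^ m - gcdSum m k n r =
      ∑ A ∈ G, (u A ^ m - (greatestDivisor A : ℝ) ^ (-(m : ℤ))) + ∑ A ∈ H, u A ^ m := by
    rw [← Finset.sum_filter_add_sum_filter_not (uniformBall (Fin n) (Fin k) r)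
      (fun A => (A.map (Int.cast : ℤ → ℚ)).rank = n), Finset.sum_sub_distrib, gcdSum]
    ring
  rw [ncard_SAT_div_card, ← sub_div, hsplit, abs_div, abs_of_pos hs, div_lt_iff₀ hs]
  have hHC := (hC r).trans_lt hdef
  rw [div_lt_iff₀ hs] at hHC
  calc _ ≤ _ := abs_add_le _ _
    _ ≤ (2 * r + 1) ^ (n * k) * (ε / 4) + H.card := add_le_add hfull hdeficient
    _ < ε * (2 * r + 1) ^ (n * k) := by nlinarith

theorem theorem5p5 (m k n : ℕ) (hnk : n ≤ k) (ρ : ℝ) :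
    HasAsymptoticDensity (uniformBall (Fin n) (Fin k ⊕ Fin m)) (SAT m k n) ρ ↔
      Tendsto (fun r : ℕ => gcdSum m k n r / (2 * (r : ℝ)) ^ (n * k)) atTop (𝓝 ρ) := by
  have hsub := tendsto_density_sub_gcdSum (m := m) hnk
  -- The ratio of the two normalisations (2r)^{nk} and (2r+1)^{nk}.
  have hc := tendsto_two_mul_add_div_pow 0 (n * k)
  have hiff : HasAsymptoticDensity (uniformBall (Fin n) (Fin k ⊕ Fin m)) (SAT m k n) ρ ↔
      Tendsto (fun r : ℕ => gcdSum m k n r / (2 * (r : ℝ) + 1) ^ (n * k)) atTop (𝓝 ρ) := by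
    constructor
    · intro h
      simpa using Tendsto.sub h hsub
    · intro h
      simpa [HasAsymptoticDensity] using hsub.add h
  rw [hiff]
  have heq : ∀ᶠ r : ℕ in atTop, gcdSum m k n r / (2 * (r : ℝ)) ^ (n * k) =
      gcdSum m k n r / (2 * (r : ℝ) + 1) ^ (n * k) /
        ((2 * (r : ℝ) + 0) / (2 * r + 1)) ^ (n * k) := by
    filter_upwards [eventually_gt_atTop 0] with r hr
    have : (0 : ℝ) < r := by exact_mod_cast hr
    rw [add_zero, div_pow]
    field_simp
  rw [tendsto_congr' heq]
  constructor
  · intro h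
    have h' := h.div hc one_ne_zero
    rw [div_one] at h'
    exact h'
  · intro h
    have h' := h.mul hc
    rw [mul_one] at h'
    refine h'.congr' ?_
    filter_upwards [eventually_gt_atTop 0] with r hr
    have : (0 : ℝ) < r := by exact_mod_cast hr
    exact div_mul_cancel₀ _ (by positivity)
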